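/- Let $\mathbb F$ be a field and let $0\neq q\in\mathbb F$ be not a root of unity. Let $\mathcal O_q$ be the associative unital $\mathbb F$-algebra with generators $A,B$ and relations $$A^3B-[3]_qA^2BA+[3]_qABA^2-BA^3=(q^2-q^{-2})^2(BA-AB),$$ $$B^3A-[3]_qB^2AB+[3]_qBAB^2-AB^3=(q^2-q^{-2})^2(AB-BA),$$ where $[n]_q=(q^n-q^{-n})/(q-q^{-1})$. An antiautomorphism of $\mathcal O_q$ is an $\mathbb F$-linear bijection $\sigma$ with $\sigma(XY)=\sigma(Y)\sigma(X)$ for all $X,Y$. Let $\mathrm{AAut}(\mathcal O_q)$ be the group, under composition, of all automorphisms and antiautomorphisms of $\mathcal O_q$. Put $$C=\frac{q^{-1}BA-qAB}{q^2-q^{-2}}.$$ There exist automorphisms $T_0,T_1$ of $\mathcal O_q$ with $$T_0(A)=A,\qquad T_0(B)=B+\frac{qA^2B-(q+q^{-1})ABA+q^{-1}BA^2}{(q-q^{-1})(q^2-q^{-2})},$$ $$T_1(B)=B,\qquad T_1(A)=A+\frac{qB^2A-(q+q^{-1})BAB+q^{-1}AB^2}{(q-q^{-1})(q^2-q^{-2})},$$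 an antiautomorphism $S$ of $\mathcal O_q$ fixing $A$ and $B$, and a group homomorphism from the free product $\mathbb Z_2\star\mathbb Z_2\star\mathbb Z_2$, with generators $a,b,c$ (subject to $a^2=b^2=c^2=1$), to $\mathrm{AAut}(\mathcal O_q)$, that is, an action of this free product on $\mathcal O_q$ by automorphisms and antiautomorphisms, such that: (i) $a$ acts as an antiautomorphism that sends $A\mapsto A+\dfrac{BC-CB}{q-q^{-1}}$, $B\mapsto B$, $C\mapsto C$; (ii) $b$ acts as an antiautomorphism that sends $B\mapsto B+\dfrac{CA-AC}{q-q^{-1}}$, $C\mapsto C$, $A\mapsto A$; (iii) $c$ acts as an antiautomorphism that sends $C\mapsto C+\dfrac{AB-BA}{q-q^{-1}}$, $A\mapsto A$, $B\mapsto B$; (iv) on $\mathcal O_q$, $a=ST_1=T_1^{-1}S$, $b=T_0S=ST_0^{-1}$, $c=S$, and $T_0=bc$, $T_0^{-1}=cb$, $T_1=ca$, $T_1^{-1}=ac$. This action is faithful, and the image of $\mathbb Z_2\star\mathbb Z_2\star\mathbb Z_2$ is the subgroup $G$ of $\mathrm{AAut}(\mathcal O_q)$ generated by $S,T_0,T_1$;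 thus $\mathbb Z_2\star\mathbb Z_2\star\mathbb Z_2\cong G$. -/

import Mathlib

/-! ## Automorphisms and antiautomorphisms of an associative unital algebra -/

/-- An `F`-linear bijection `σ` of `R` is an automorphism of the algebra `R` if `σ (x y) = σ x σ y`.
(Preservation of `1` is automatic because `σ` is surjective.) -/
def IsAlgAut {F R : Type*} [Field F] [Ring R] [Algebra F R] (σ : R ≃ₗ[F] R) : Prop :=
  ∀ x y : R, σ (x * y) = σ x * σ y

/-- An `F`-linear bijection `σ` of `R` is an antiautomorphism of the algebra `R` if
`σ (x y) = σ y σ x`. -/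
def IsAlgAntiaut {F R : Type*} [Field F] [Ring R] [Algebra F R] (σ : R ≃ₗ[F] R) : Prop :=
  ∀ x y : R, σ (x * y) = σ y * σ x

/-- The group of all automorphisms and antiautomorphisms of the algebra `R`; the group operation
is composition, `(σ * τ) x = σ (τ x)`. -/
def AAut (F R : Type*) [Field F] [Ring R] [Algebra F R] : Subgroup (R ≃ₗ[F] R) where
  carrier := {σ | IsAlgAut σ ∨ IsAlgAntiaut σ}
  one_mem' := Or.inl fun _ _ => rfl
  mul_mem' := by
    rintro σ τ (hσ | hσ) (hτ | hτ)
    · exact Or.inl fun x y => by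
        simp only [LinearEquiv.mul_apply]; rw [hτ x y, hσ]
    · exact Or.inr fun x y => by
        simp only [LinearEquiv.mul_apply]; rw [hτ x y, hσ]
    · exact Or.inr fun x y => by
        simp only [LinearEquiv.mul_apply]; rw [hτ x y, hσ]
    · exact Or.inl fun x y => by
        simp only [LinearEquiv.mul_apply]; rw [hτ x y, hσ]
  inv_mem' := by
    rintro σ (hσ | hσ)
    · refine Or.inl fun x y => σ.injective ?_
      rw [hσ]
      change σ (σ.symm _) = σ (σ.symm _) * σ (σ.symm _)
      simp only [LinearEquiv.apply_symm_apply]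
    · refine Or.inr fun x y => σ.injective ?_
      rw [hσ]
      change σ (σ.symm _) = σ (σ.symm _) * σ (σ.symm _)
      simp only [LinearEquiv.apply_symm_apply]

/-! ## The `q`-Onsager algebra -/

/-- The `q`-integer `[n]_q = (q ^ n - q ^ (-n)) / (q - q⁻¹)`. -/
def qInt {F : Type*} [Field F] (q : F) (n : ℕ) : F :=
  (q ^ n - (q⁻¹) ^ n) / (q - q⁻¹)

/-- The two `q`-Dolan/Grady relations on the free algebra with generators
`A = FreeAlgebra.ι F 0` and `B = FreeAlgebra.ι F 1`. -/
inductive DolanGradyRel {F : Type*} [Field F] (q : F) :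
    FreeAlgebra F (Fin 2) → FreeAlgebra F (Fin 2) → Prop
  | rel₁ (A B : FreeAlgebra F (Fin 2)) (hA : A = FreeAlgebra.ι F 0) (hB : B = FreeAlgebra.ι F 1) :
      DolanGradyRel q
        (A ^ 3 * B - qInt q 3 • (A ^ 2 * B * A) + qInt q 3 • (A * B * A ^ 2) - B * A ^ 3)
        ((q ^ 2 - (q⁻¹) ^ 2) ^ 2 • (B * A - A * B))
  | rel₂ (A B : FreeAlgebra F (Fin 2)) (hA : A = FreeAlgebra.ι F 0) (hB : B = FreeAlgebra.ι F 1) :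
      DolanGradyRel q
        (B ^ 3 * A - qInt q 3 • (B ^ 2 * A * B) + qInt q 3 • (B * A * B ^ 2) - A * B ^ 3)
        ((q ^ 2 - (q⁻¹) ^ 2) ^ 2 • (A * B - B * A))

/-- The `q`-Onsager algebra `O_q`: generators `A`, `B` and the `q`-Dolan/Grady relations. -/
abbrev QOnsager {F : Type*} [Field F] (q : F) : Type _ :=
  RingQuot (DolanGradyRel q)

namespace QOnsager

/-- The generator `A` of `O_q`. -/
noncomputable def A {F : Type*} [Field F] (q : F) : QOnsager q :=
  RingQuot.mkAlgHom F (DolanGradyRel q) (FreeAlgebra.ι F 0)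

/-- The generator `B` of `O_q`. -/
noncomputable def B {F : Type*} [Field F] (q : F) : QOnsager q :=
  RingQuot.mkAlgHom F (DolanGradyRel q) (FreeAlgebra.ι F 1)

/-- The element `C = (q⁻¹ B A - q A B) / (q² - q⁻²)` of `O_q`. -/
noncomputable def C {F : Type*} [Field F] (q : F) : QOnsager q :=
  (q ^ 2 - (q⁻¹) ^ 2)⁻¹ • (q⁻¹ • (B q * A q) - q • (A q * B q))

end QOnsager

/-- The defining property of the Baseilhac-Kolb automorphism `T₀` of `O_q`: it is the automorphism
with `T₀ A = A` and
`T₀ B = B + (q A² B - (q + q⁻¹) A B A + q⁻¹ B A²) / ((q - q⁻¹) (q² - q⁻²))`. -/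
def IsBaseilhacKolbT₀ {F : Type*} [Field F] (q : F) (T : QOnsager q ≃ₗ[F] QOnsager q) : Prop :=
  IsAlgAut T ∧ T (QOnsager.A q) = QOnsager.A q ∧
    T (QOnsager.B q) = QOnsager.B q + ((q - q⁻¹) * (q ^ 2 - (q⁻¹) ^ 2))⁻¹ •
      (q • (QOnsager.A q ^ 2 * QOnsager.B q)
        - (q + q⁻¹) • (QOnsager.A q * QOnsager.B q * QOnsager.A q)
        + q⁻¹ • (QOnsager.B q * QOnsager.A q ^ 2))

/-- The defining property of the Baseilhac-Kolb automorphism `T₁` of `O_q`: it is the automorphism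
with `T₁ B = B` and
`T₁ A = A + (q B² A - (q + q⁻¹) B A B + q⁻¹ A B²) / ((q - q⁻¹) (q² - q⁻²))`. -/
def IsBaseilhacKolbT₁ {F : Type*} [Field F] (q : F) (T : QOnsager q ≃ₗ[F] QOnsager q) : Prop :=
  IsAlgAut T ∧ T (QOnsager.B q) = QOnsager.B q ∧
    T (QOnsager.A q) = QOnsager.A q + ((q - q⁻¹) * (q ^ 2 - (q⁻¹) ^ 2))⁻¹ •
      (q • (QOnsager.B q ^ 2 * QOnsager.A q)
        - (q + q⁻¹) • (QOnsager.B q * QOnsager.A q * QOnsager.B q)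
        + q⁻¹ • (QOnsager.A q * QOnsager.B q ^ 2))

/-! ## The free product of three groups of order two -/

/-- The free product `ℤ₂ ⋆ ℤ₂ ⋆ ℤ₂`. -/
abbrev FreeProductZ₂ : Type := Monoid.CoprodI (fun _ : Fin 3 => Multiplicative (ZMod 2))

namespace FreeProductZ₂

/-- The generator of the first free factor. -/
def a : FreeProductZ₂ :=
  Monoid.CoprodI.of (M := fun _ : Fin 3 => Multiplicative (ZMod 2)) (i := 0)
    (Multiplicative.ofAdd 1)

/-- The generator of the second free factor. -/
def b : FreeProductZ₂ :=
  Monoid.CoprodI.of (M := fun _ : Fin 3 => Multiplicative (ZMod 2)) (i := 1)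
    (Multiplicative.ofAdd 1)

/-- The generator of the third free factor. -/
def c : FreeProductZ₂ :=
  Monoid.CoprodI.of (M := fun _ : Fin 3 => Multiplicative (ZMod 2)) (i := 2)
    (Multiplicative.ofAdd 1)

end FreeProductZ₂

/-! Existence. The substance is that the Lusztig move `B' = B + [C, A]/(q - q⁻¹)` sends a
Dolan/Grady pair `(A, B)` to a Dolan/Grady pair `(A, B')` (`IsDolanGrady.lusztigMove`). Rewritten
with `C`, each relation is cubic and says that a Casimir-like element commutes with a generator:
with `u = q² - q⁻²`, the relations become `[β, A] = 0` and `[α, B] = 0`, where `u α = u A + q B C -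
q⁻¹ C B` and `u β = u B + q C A - q⁻¹ A C`. The move keeps `C` but reverses its definition
(`IsDolanGrady.qBracket_lusztigMove`), so it belongs to an antiautomorphism. The only hard relation
left, `[α', B'] = 0` for the new `α'`, is an explicit ideal-membership identity
(`commutator_certificate`). An antiautomorphism fixing `A` and `C` negates `[C, A]`, so it is an
involution. The symmetry exchanging `A` and `B` in the opposite algebra gives the second reflection,
and reversal of words the third.

Faithfulness. Send `A`, `B` to the symmetrized monomials `E (1, 0)`, `E (0, 1)` of the quantum
torus; then `C` goes to `-E (1, 1)`. The three antiautomorphisms are intertwined with determinant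
`-1` maps of `ℤ²`, the reflections in the sides of an ideal triangle of the Farey tessellation
(`toTorus_reflHom`). Each reflection carries the regions beyond the other two sides into the region
beyond its own side, and ping-pong applies. -/

set_option linter.unusedSimpArgs false

/-! ## The `q`-Dolan/Grady relations in an arbitrary algebra -/

section DolanGrady

variable {F R : Type*} [Field F] [Ring R] [Algebra F R]

/-- Two elements of an `F`-algebra satisfy the `q`-Dolan/Grady relations. -/
structure IsDolanGrady (q : F) (A B : R) : Prop where
  rel₁ : A ^ 3 * B - qInt q 3 • (A ^ 2 * B * A) + qInt q 3 • (A * B * A ^ 2) - B * A ^ 3 =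
    (q ^ 2 - (q⁻¹) ^ 2) ^ 2 • (B * A - A * B)
  rel₂ : B ^ 3 * A - qInt q 3 • (B ^ 2 * A * B) + qInt q 3 • (B * A * B ^ 2) - A * B ^ 3 =
    (q ^ 2 - (q⁻¹) ^ 2) ^ 2 • (A * B - B * A)

/-- The element `(q⁻¹ B A - q A B) / (q² - q⁻²)` attached to a pair of elements. -/
def qBracket (q : F) (A B : R) : R :=
  (q ^ 2 - (q⁻¹) ^ 2)⁻¹ • (q⁻¹ • (B * A) - q • (A * B))

/-- The element `B + (C A - A C) / (q - q⁻¹)`, where `C` is the `q`-bracket of `A` and `B`. -/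
def lusztigMove (q : F) (A B : R) : R :=
  B + (q - q⁻¹)⁻¹ • (qBracket q A B * A - A * qBracket q A B)

theorem IsDolanGrady.swap {q : F} {A B : R} (h : IsDolanGrady q A B) : IsDolanGrady q B A :=
  ⟨h.rel₂, h.rel₁⟩

/-- Reversing words turns each relation into its negative. Hence antihomomorphisms out of `O_q` come
from Dolan/Grady pairs just as homomorphisms do. -/
theorem isDolanGrady_op_iff {q : F} {A B : R} :
    IsDolanGrady q (MulOpposite.op A) (MulOpposite.op B) ↔ IsDolanGrady q A B := by
  constructor
  · intro h
    have h₁ := congrArg MulOpposite.unop h.rel₁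
    have h₂ := congrArg MulOpposite.unop h.rel₂
    simp only [MulOpposite.unop_sub, MulOpposite.unop_add, MulOpposite.unop_smul,
      MulOpposite.unop_mul, MulOpposite.unop_pow, MulOpposite.unop_op, mul_assoc] at h₁ h₂
    constructor
    · simp only [mul_assoc]
      linear_combination (norm := module) -h₁
    · simp only [mul_assoc]
      linear_combination (norm := module) -h₂
  · intro h
    have h₁ := congrArg MulOpposite.op h.rel₁
    have h₂ := congrArg MulOpposite.op h.rel₂
    simp only [MulOpposite.op_sub, MulOpposite.op_add, MulOpposite.op_smul, MulOpposite.op_mul,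
      MulOpposite.op_pow, mul_assoc] at h₁ h₂
    constructor
    · simp only [mul_assoc]
      linear_combination (norm := module) -h₁
    · simp only [mul_assoc]
      linear_combination (norm := module) -h₂

end DolanGrady

/-! ### Nonvanishing of the scalars that get inverted. -/

section Scalars

variable {F : Type*} [Field F] {q : F}

theorem one_sub_pow_ne_zero (hroot : ∀ n : ℕ, 0 < n → q ^ n ≠ 1) {n : ℕ} (hn : 0 < n) :
    1 - q ^ n ≠ 0 :=
  sub_ne_zero.mpr (hroot n hn).symm

theorem sub_inv_ne_zero_of_not_root (hq : q ≠ 0) (hroot : ∀ n : ℕ, 0 < n → q ^ n ≠ 1) :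
    q - q⁻¹ ≠ 0 := by
  intro h
  apply hroot 2 two_pos
  field_simp at h
  linear_combination h

theorem sq_sub_inv_sq_ne_zero_of_not_root (hq : q ≠ 0) (hroot : ∀ n : ℕ, 0 < n → q ^ n ≠ 1) :
    q ^ 2 - q⁻¹ ^ 2 ≠ 0 := by
  intro h
  apply hroot 4 (by norm_num)
  field_simp at h
  linear_combination h

theorem qInt_three (hk : q - q⁻¹ ≠ 0) (hq : q ≠ 0) :
    qInt q 3 = q ^ 2 + 1 + q⁻¹ ^ 2 := by
  rw [qInt, div_eq_iff hk]
  field_simp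
  ring

end Scalars

/-! ### The Lusztig move preserves the Dolan/Grady relations. -/

section Identities

variable {F R : Type*} [Field F] [Ring R] [Algebra F R] {q : F} {A B C X Y δ α β : R}

theorem smul_qBracket (hu : q ^ 2 - q⁻¹ ^ 2 ≠ 0) (A B : R) :
    (q ^ 2 - q⁻¹ ^ 2) • qBracket q A B - q⁻¹ • (B * A) + q • (A * B) = 0 := by
  rw [qBracket, smul_inv_smul₀ hu]
  abel

/-- The first Dolan/Grady relation as a cubic relation between `A` and `C`. -/
theorem dolanGrady_rel₁_iff (hq : q ≠ 0) (hk : q - q⁻¹ ≠ 0) (hu : q ^ 2 - q⁻¹ ^ 2 ≠ 0)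
    (hC : (q ^ 2 - q⁻¹ ^ 2) • C - q⁻¹ • (B * A) + q • (A * B) = 0) :
    A ^ 3 * B - qInt q 3 • (A ^ 2 * B * A) + qInt q 3 • (A * B * A ^ 2) - B * A ^ 3 =
      (q ^ 2 - (q⁻¹) ^ 2) ^ 2 • (B * A - A * B) ↔
    (q ^ 2 - q⁻¹ ^ 2) • (A * B - B * A) - q • ((C * A - A * C) * A) +
      q⁻¹ • (A * (C * A - A * C)) = 0 := by
  rw [← sub_eq_zero, qInt_three hk hq]
  have key : A ^ 3 * B - (q ^ 2 + 1 + q⁻¹ ^ 2) • (A ^ 2 * B * A) +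
        (q ^ 2 + 1 + q⁻¹ ^ 2) • (A * B * A ^ 2) - B * A ^ 3 -
        (q ^ 2 - (q⁻¹) ^ 2) ^ 2 • (B * A - A * B) =
      (q ^ 2 - q⁻¹ ^ 2) • ((q ^ 2 - q⁻¹ ^ 2) • (A * B - B * A) - q • ((C * A - A * C) * A) +
      q⁻¹ • (A * (C * A - A * C))) := by
    -- The operator `z ↦ q z A² - (q + q⁻¹) A z A + q⁻¹ A² z`, a commutator with `A` followed by a
    -- `q`-commutator, is applied to the definition of `C`.
    linear_combination (norm := skip) q • (hC * (A * A)) - (q + q⁻¹) • (A * hC * A) +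
      q⁻¹ • (A * A * hC)
    simp only [pow_succ, pow_zero, one_mul, mul_add, add_mul, mul_sub, sub_mul, smul_add, smul_sub,
      smul_mul_assoc, mul_smul_comm, mul_assoc, mul_zero, zero_mul]
    match_scalars <;> field_simp <;> ring
  rw [key, smul_eq_zero_iff_right hu]

/-- The second Dolan/Grady relation as a cubic relation between `B` and `C`. -/
theorem dolanGrady_rel₂_iff (hq : q ≠ 0) (hk : q - q⁻¹ ≠ 0) (hu : q ^ 2 - q⁻¹ ^ 2 ≠ 0)
    (hC : (q ^ 2 - q⁻¹ ^ 2) • C - q⁻¹ • (B * A) + q • (A * B) = 0) :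
    B ^ 3 * A - qInt q 3 • (B ^ 2 * A * B) + qInt q 3 • (B * A * B ^ 2) - A * B ^ 3 =
      (q ^ 2 - (q⁻¹) ^ 2) ^ 2 • (A * B - B * A) ↔
    (q ^ 2 - q⁻¹ ^ 2) • (A * B - B * A) - q • (B * (B * C - C * B)) +
      q⁻¹ • ((B * C - C * B) * B) = 0 := by
  -- Exchanging `A` and `B` in the opposite algebra preserves the definition of `C`, so this is the
  -- first equivalence transported.
  have h := dolanGrady_rel₁_iff (R := Rᵐᵒᵖ) (A := MulOpposite.op B) (B := MulOpposite.op A)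
    (C := MulOpposite.op C) hq hk hu (by
      rw [← MulOpposite.op_zero, ← hC]
      simp only [MulOpposite.op_sub, MulOpposite.op_add, MulOpposite.op_smul, MulOpposite.op_mul])
  rw [← (MulOpposite.op_injective (α := R)).eq_iff, ← neg_inj,
    ← (MulOpposite.op_injective (α := R)).eq_iff (b := 0)]
  convert h using 2
  · simp only [MulOpposite.op_sub, MulOpposite.op_add, MulOpposite.op_smul, MulOpposite.op_mul,
      MulOpposite.op_pow, mul_assoc]
    abel
  · simp only [MulOpposite.op_sub, MulOpposite.op_smul, MulOpposite.op_mul]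
    rw [← smul_neg, neg_sub]
  · simp only [MulOpposite.op_sub, MulOpposite.op_add, MulOpposite.op_smul, MulOpposite.op_mul]
  · exact MulOpposite.op_zero

theorem commutator_B_of_rel₂ (hu : q ^ 2 - q⁻¹ ^ 2 ≠ 0)
    (hα : (q ^ 2 - q⁻¹ ^ 2) • α = (q ^ 2 - q⁻¹ ^ 2) • A + q • (B * C) - q⁻¹ • (C * B))
    (hR₂ : (q ^ 2 - q⁻¹ ^ 2) • (A * B - B * A) - q • (B * (B * C - C * B)) +
      q⁻¹ • ((B * C - C * B) * B) = 0) : α * B - B * α = 0 := by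
  rw [← smul_eq_zero_iff_right hu]
  linear_combination (norm := skip) hα * B - B * hα + hR₂
  simp only [mul_add, add_mul, mul_sub, sub_mul, smul_sub,
    smul_mul_assoc, mul_smul_comm, mul_assoc]
  match_scalars <;> ring

theorem commutator_A_of_rel₁ (hu : q ^ 2 - q⁻¹ ^ 2 ≠ 0)
    (hβ : (q ^ 2 - q⁻¹ ^ 2) • β = (q ^ 2 - q⁻¹ ^ 2) • B + q • (C * A) - q⁻¹ • (A * C))
    (hR₁ : (q ^ 2 - q⁻¹ ^ 2) • (A * B - B * A) - q • ((C * A - A * C) * A) +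
      q⁻¹ • (A * (C * A - A * C)) = 0) : β * A - A * β = 0 := by
  rw [← smul_eq_zero_iff_right hu]
  linear_combination (norm := skip) hβ * A - A * hβ - hR₁
  simp only [mul_add, add_mul, mul_sub, sub_mul, smul_sub,
    smul_mul_assoc, mul_smul_comm, mul_assoc]
  match_scalars <;> ring

/-- The cyclic identity `[α, A] + [β, B] + [γ, C] = 0`, where the third Casimir-like element `γ` is
zero by the definition of `C`. -/
theorem commutator_add_commutator (hq : q ≠ 0) (hu : q ^ 2 - q⁻¹ ^ 2 ≠ 0)
    (hC : (q ^ 2 - q⁻¹ ^ 2) • C - q⁻¹ • (B * A) + q • (A * B) = 0)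
    (hα : (q ^ 2 - q⁻¹ ^ 2) • α = (q ^ 2 - q⁻¹ ^ 2) • A + q • (B * C) - q⁻¹ • (C * B))
    (hβ : (q ^ 2 - q⁻¹ ^ 2) • β = (q ^ 2 - q⁻¹ ^ 2) • B + q • (C * A) - q⁻¹ • (A * C)) :
    (α * A - A * α) + (β * B - B * β) = 0 := by
  rw [← smul_eq_zero_iff_right hu]
  linear_combination (norm := skip) hα * A - A * hα + hβ * B - B * hβ -
    (hC * C - C * hC)
  simp only [mul_add, add_mul, mul_sub, sub_mul, smul_add, smul_sub,
    smul_mul_assoc, mul_smul_comm, mul_assoc, mul_zero, zero_mul]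
  match_scalars <;> field_simp <;> ring

/-- For `X = [β, C]`, `δ = [α, A]`, `Y = [α, C]`, and given `[α, B] = 0`, the left side is `(q -
q⁻¹)² [α', B']` with `(q - q⁻¹) α' = (q - q⁻¹) α - X`, by the Jacobi identity. The Casimir-like
elements enter only through these brackets. -/
theorem commutator_certificate (hq : q ≠ 0) (hroot : ∀ n : ℕ, 0 < n → q ^ n ≠ 1)
    (hC : (q ^ 2 - q⁻¹ ^ 2) • C - q⁻¹ • (B * A) + q • (A * B) = 0)
    (hR₁ : (q ^ 2 - q⁻¹ ^ 2) • (A * B - B * A) - q • ((C * A - A * C) * A) +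
      q⁻¹ • (A * (C * A - A * C)) = 0)
    (hX : (q ^ 2 - q⁻¹ ^ 2) • X - q • (A * δ) + q⁻¹ • (δ * A) = 0)
    (hδ : (q ^ 2 - q⁻¹ ^ 2) • δ - q • (X * A) + q⁻¹ • (A * X) = 0)
    (hY : (q ^ 2 - q⁻¹ ^ 2) • Y - q⁻¹ • (B * δ) + q • (δ * B) = 0)
    (hJ : (q + q⁻¹) • (δ * C - C * δ) - q • (B * X) + q⁻¹ • (X * B) - q • (Y * A) +
      q⁻¹ • (A * Y) = 0) :
    (q - q⁻¹) • ((Y * A - A * Y) + (C * δ - δ * C) - (X * B - B * X)) -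
      (X * (C * A - A * C) - (C * A - A * C) * X) = 0 := by
  -- The certificate has its denominators cleared; this common multiplier is nonzero because `q` is
  -- not a root of unity.
  have hN : (1 - q ^ 4) * (1 - q ^ 6) * (1 - q ^ 8) ≠ 0 :=
    mul_ne_zero (mul_ne_zero (one_sub_pow_ne_zero hroot (by norm_num))
      (one_sub_pow_ne_zero hroot (by norm_num))) (one_sub_pow_ne_zero hroot (by norm_num))
  rw [← smul_eq_zero_iff_right hN]
  -- Every summand is a hypothesis multiplied on both sides by words in the letters; after
  -- expansion, all words cancel in the free algebra.
  linear_combination (norm := skip) (q - q⁻¹) • (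
    (q ^ 4 - q ^ 6 - q ^ 8 + q ^ 12 + q ^ 14 - q ^ 16) • (hC * δ) +
    (q ^ 2 - q ^ 4 - q ^ 6 + q ^ 10 + q ^ 12 - q ^ 14) • (δ * hC) +
    (-q ^ 3 + q ^ 7 + q ^ 9 - q ^ 13) • (A * hC * X) +
    (q ^ 5 - q ^ 9) • (A * X * hC) +
    (q ^ 5 - q ^ 9 - q ^ 11 + q ^ 15) • (X * hC * A) +
    (q ^ 10) • (hC * (δ * A * A)) +
    (-q ^ 8 - q ^ 10) • (A * hC * (δ * A)) +
    (q ^ 8) • (A * A * hC * δ) +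
    (q ^ 8 + q ^ 10) • (A * δ * hC * A) +
    (-q ^ 6) • (A * δ * A * hC) +
    (-q ^ 10) • (δ * hC * (A * A)) +
    (-q ^ 7 - q ^ 9 + q ^ 13 + q ^ 15) • (hR₁ * δ) +
    (q ^ 3 + q ^ 5 - q ^ 9 - q ^ 11) • (δ * hR₁) +
    (q ^ 2 - q ^ 8 - q ^ 10 + q ^ 16) • (hX * B) +
    (-q ^ 2 + q ^ 8 + q ^ 10 - q ^ 16) • (B * hX) +
    (q ^ 3 + q ^ 5 - q ^ 9 - q ^ 11) • (hX * (A * C)) +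
    (-q ^ 3 - 2 * q ^ 5 - q ^ 7 + q ^ 9 + 2 * q ^ 11 + q ^ 13) • (hX * (C * A)) +
    (q ^ 7 + q ^ 9 - q ^ 11 - q ^ 13) • (A * hX * C) +
    (-q ^ 5 - 2 * q ^ 7 - q ^ 9 + q ^ 11 + 2 * q ^ 13 + q ^ 15) • (A * C * hX) +
    (q ^ 5 + q ^ 7 - q ^ 11 - q ^ 13) • (C * hX * A) +
    (q ^ 7 + q ^ 9 - q ^ 13 - q ^ 15) • (C * A * hX) +
    (q ^ 12) • (hX * (B * A * A)) +
    (q ^ 8) • (A * hX * (A * B)) +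
    (-q ^ 6 - q ^ 10 - q ^ 12) • (A * hX * (B * A)) +
    (q ^ 10) • (A * A * hX * B) +
    (-q ^ 6) • (A * A * B * hX) +
    (q ^ 6 + q ^ 8) • (A * B * hX * A) +
    (-q ^ 8) • (B * hX * (A * A)) +
    (q ^ 4 + q ^ 6 - q ^ 8 - 2 * q ^ 10 - q ^ 12 + q ^ 14 + q ^ 16) • (hδ * C) +
    (-q ^ 2 - q ^ 4 + q ^ 6 + 2 * q ^ 8 + q ^ 10 - q ^ 12 - q ^ 14) • (C * hδ) +
    (q ^ 5 - q ^ 9 - q ^ 11 + q ^ 15) • (hδ * (B * A)) +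
    (-q ^ 3 + q ^ 7 + q ^ 9 - q ^ 13) • (A * B * hδ) +
    (-q ^ 2 + q ^ 8 + q ^ 10 - q ^ 16) • (hY * A) +
    (q ^ 2 - q ^ 8 - q ^ 10 + q ^ 16) • (A * hY) +
    (-q ^ 8) • (hY * (A * A * A)) +
    (q ^ 6 + q ^ 8 + q ^ 12) • (A * hY * (A * A)) +
    (-q ^ 6 - q ^ 10 - q ^ 12) • (A * A * hY * A) +
    (q ^ 10) • (A * A * A * hY) +
    (q ^ 5 - q ^ 9) • (hJ * (A * A)) +
    (-q ^ 5 + q ^ 13) • (A * hJ * A) +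
    (q ^ 9 - q ^ 13) • (A * A * hJ))
  simp only [mul_add, add_mul, mul_sub, sub_mul, smul_add, smul_sub,
    smul_mul_assoc, mul_smul_comm, mul_assoc, mul_zero, zero_mul]
  match_scalars <;> field_simp <;> ring

theorem smul_lusztigMove (hk : q - q⁻¹ ≠ 0) (A B : R) : (q - q⁻¹) • lusztigMove q A B =
    (q - q⁻¹) • B + (qBracket q A B * A - A * qBracket q A B) := by
  rw [lusztigMove, smul_add, smul_inv_smul₀ hk]

/-- With denominators cleared, the difference of the two sides is the cubic form of the first
relation. The arguments appear in reversed order because the move comes from an antiautomorphism;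
this lemma is what makes that map fix `C`. -/
theorem IsDolanGrady.qBracket_lusztigMove (hq : q ≠ 0) (hroot : ∀ n : ℕ, 0 < n → q ^ n ≠ 1)
    (h : IsDolanGrady q A B) : qBracket q (lusztigMove q A B) A = qBracket q A B := by
  have hk := sub_inv_ne_zero_of_not_root hq hroot
  have hu := sq_sub_inv_sq_ne_zero_of_not_root hq hroot
  have hC := smul_qBracket hu A B
  have hR₁ := (dolanGrady_rel₁_iff hq hk hu hC).1 h.rel₁
  have hB' := smul_lusztigMove hk A B
  have hC' := smul_qBracket hu (lusztigMove q A B) A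
  generalize lusztigMove q A B = B' at hB' hC' ⊢
  generalize qBracket q A B = C at hB' hC hR₁ ⊢
  generalize qBracket q B' A = C' at hC' ⊢
  rw [← sub_eq_zero, ← smul_eq_zero_iff_right (mul_ne_zero hk hu)]
  linear_combination (norm := skip) (q - q⁻¹) • hC' + q⁻¹ • (A * hB') - q • (hB' * A) -
    (q - q⁻¹) • hC + hR₁
  simp only [mul_add, add_mul, mul_sub, sub_mul, smul_add, smul_sub,
    smul_mul_assoc, mul_smul_comm, mul_assoc, mul_zero, zero_mul]
  match_scalars <;> field_simp <;> ring

/-- Replacing `B` by its Lusztig move preserves the Dolan/Grady relations. -/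
theorem IsDolanGrady.lusztigMove (hq : q ≠ 0) (hroot : ∀ n : ℕ, 0 < n → q ^ n ≠ 1)
    (h : IsDolanGrady q A B) : IsDolanGrady q A (lusztigMove q A B) := by
  have hk := sub_inv_ne_zero_of_not_root hq hroot
  have hu := sq_sub_inv_sq_ne_zero_of_not_root hq hroot
  have hC := smul_qBracket hu A B
  have hB' := smul_lusztigMove hk A B
  have hC' := smul_qBracket hu (_root_.lusztigMove q A B) A
  rw [h.qBracket_lusztigMove hq hroot] at hC'
  generalize _root_.lusztigMove q A B = B' at hB' hC' ⊢
  generalize qBracket q A B = C at hC hB' hC'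
  have hR₁ := (dolanGrady_rel₁_iff hq hk hu hC).1 h.rel₁
  have hR₂ := (dolanGrady_rel₂_iff hq hk hu hC).1 h.rel₂
  -- In the universal Askey-Wilson algebra these elements are central. Here only `[α, B]`, `[β, A]`
  -- and `[α, A] + [β, B]` are known to vanish.
  obtain ⟨α, hα⟩ : ∃ α, (q ^ 2 - q⁻¹ ^ 2) • α =
      (q ^ 2 - q⁻¹ ^ 2) • A + q • (B * C) - q⁻¹ • (C * B) := ⟨_, smul_inv_smul₀ hu _⟩
  obtain ⟨β, hβ⟩ : ∃ β, (q ^ 2 - q⁻¹ ^ 2) • β =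
      (q ^ 2 - q⁻¹ ^ 2) • B + q • (C * A) - q⁻¹ • (A * C) := ⟨_, smul_inv_smul₀ hu _⟩
  have hαB := commutator_B_of_rel₂ hu hα hR₂
  have hβA := commutator_A_of_rel₁ hu hβ hR₁
  have hαA := commutator_add_commutator hq hu hC hα hβ
  -- The next four identities arise by bracketing definitions: `β` with that of `C`, `β` with its
  -- own, `α` with that of `C`, and finally `[α, β] + [β, α] = 0` with both definitions expanded.
  have hX : (q ^ 2 - q⁻¹ ^ 2) • (β * C - C * β) - q • (A * (α * A - A * α)) +
      q⁻¹ • ((α * A - A * α) * A) = 0 := by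
    linear_combination (norm := skip) (β * hC - hC * β) + q⁻¹ • (hαA * A) - q • (A * hαA) +
      q⁻¹ • (B * hβA) - q • (hβA * B)
    simp only [mul_add, add_mul, mul_sub, sub_mul, smul_add, smul_sub,
      smul_mul_assoc, mul_smul_comm, mul_assoc, mul_zero, zero_mul]
    match_scalars <;> field_simp <;> ring
  have hδ : (q ^ 2 - q⁻¹ ^ 2) • (α * A - A * α) - q • ((β * C - C * β) * A) +
      q⁻¹ • (A * (β * C - C * β)) = 0 := by
    linear_combination (norm := skip) (q ^ 2 - q⁻¹ ^ 2) • hαA + (β * hβ - hβ * β) +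
      q • (C * hβA) - q⁻¹ • (hβA * C)
    simp only [mul_add, add_mul, mul_sub, sub_mul, smul_add, smul_sub,
      smul_mul_assoc, mul_smul_comm, mul_assoc, mul_zero, zero_mul]
    match_scalars <;> field_simp <;> ring
  have hY : (q ^ 2 - q⁻¹ ^ 2) • (α * C - C * α) - q⁻¹ • (B * (α * A - A * α)) +
      q • ((α * A - A * α) * B) = 0 := by
    linear_combination (norm := skip) (α * hC - hC * α) + q⁻¹ • (hαB * A) - q • (A * hαB)
    simp only [mul_add, add_mul, mul_sub, sub_mul, smul_add, smul_sub,
      smul_mul_assoc, mul_smul_comm, mul_assoc, mul_zero, zero_mul]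
    match_scalars <;> field_simp <;> ring
  have hJ : (q + q⁻¹) • ((α * A - A * α) * C - C * (α * A - A * α)) -
      q • (B * (β * C - C * β)) + q⁻¹ • ((β * C - C * β) * B) -
      q • ((α * C - C * α) * A) + q⁻¹ • (A * (α * C - C * α)) = 0 := by
    linear_combination (norm := skip) (α * hβ - hβ * α) - (hα * β - β * hα) +
      (q ^ 2 - q⁻¹ ^ 2) • hαB + (q ^ 2 - q⁻¹ ^ 2) • hβA + q • (hαA * C) - q⁻¹ • (C * hαA)
    simp only [mul_add, add_mul, mul_sub, sub_mul, smul_add, smul_sub,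
      smul_mul_assoc, mul_smul_comm, mul_assoc, mul_zero, zero_mul]
    match_scalars <;> field_simp <;> ring
  have hG := commutator_certificate hq hroot hC hR₁ hX hδ hY hJ
  -- `α'` is the Casimir-like element of the new triple `A`, `B'`, `C` in the opposite algebra, as
  -- `hα''` confirms. Its commuting with `B'` is the new second relation.
  obtain ⟨α', hα'⟩ : ∃ α', (q - q⁻¹) • α' = (q - q⁻¹) • α - (β * C - C * β) :=
    ⟨_, smul_inv_smul₀ hk _⟩
  have hα'' : (q ^ 2 - q⁻¹ ^ 2) • α' - (q ^ 2 - q⁻¹ ^ 2) • A - q • (C * B') + q⁻¹ • (B' * C) =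
      0 := by
    rw [← smul_eq_zero_iff_right hk]
    linear_combination (norm := skip) (q ^ 2 - q⁻¹ ^ 2) • hα' + (q - q⁻¹) • hα -
      (hβ * C - C * hβ) - q • (C * hB') + q⁻¹ • (hB' * C)
    simp only [mul_add, add_mul, mul_sub, sub_mul, smul_add, smul_sub,
      smul_mul_assoc, mul_smul_comm, mul_assoc, mul_zero, zero_mul]
    match_scalars <;> field_simp <;> ring
  have hα'B' : α' * B' - B' * α' = 0 := by
    rw [← smul_eq_zero_iff_right (mul_ne_zero hk hk)]
    linear_combination (norm := skip) hα' * ((q - q⁻¹) • B') +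
      ((q - q⁻¹) • α - (β * C - C * β)) * hB' - ((q - q⁻¹) • B') * hα' -
      hB' * ((q - q⁻¹) • α - (β * C - C * β)) + ((q - q⁻¹) * (q - q⁻¹)) • hαB + hG
    simp only [mul_add, add_mul, mul_sub, sub_mul, smul_add, smul_sub,
      smul_mul_assoc, mul_smul_comm, mul_assoc, mul_zero, zero_mul]
    match_scalars <;> field_simp <;> ring
  have hR₁' : (q ^ 2 - q⁻¹ ^ 2) • (B' * A - A * B') - q • (A * (A * C - C * A)) +
      q⁻¹ • ((A * C - C * A) * A) = 0 := by
    rw [← smul_eq_zero_iff_right hk]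
    linear_combination (norm := skip) (q ^ 2 - q⁻¹ ^ 2) • (hB' * A - A * hB') - (q - q⁻¹) • hR₁
    simp only [mul_add, add_mul, mul_sub, sub_mul, smul_add, smul_sub,
      smul_mul_assoc, mul_smul_comm, mul_assoc, mul_zero, zero_mul]
    match_scalars <;> field_simp <;> ring
  have hR₂' : (q ^ 2 - q⁻¹ ^ 2) • (B' * A - A * B') - q • ((C * B' - B' * C) * B') +
      q⁻¹ • (B' * (C * B' - B' * C)) = 0 := by
    linear_combination (norm := skip) hα'' * B' - B' * hα'' - (q ^ 2 - q⁻¹ ^ 2) • hα'B'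
    simp only [mul_add, add_mul, mul_sub, sub_mul, smul_add, smul_sub,
      smul_mul_assoc, mul_smul_comm, mul_assoc, mul_zero, zero_mul]
    match_scalars <;> field_simp <;> ring
  rw [← isDolanGrady_op_iff]
  refine ⟨(dolanGrady_rel₁_iff (C := MulOpposite.op C) hq hk hu ?_).2 ?_,
    (dolanGrady_rel₂_iff (C := MulOpposite.op C) hq hk hu ?_).2 ?_⟩
  · exact congrArg MulOpposite.op hC'
  · exact congrArg MulOpposite.op hR₁'
  · exact congrArg MulOpposite.op hC'
  · exact congrArg MulOpposite.op hR₂'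

end Identities

/-! ## Homomorphisms and antihomomorphisms out of the `q`-Onsager algebra -/

namespace QOnsager

variable {F : Type*} [Field F] {q : F}

theorem isDolanGrady (q : F) : IsDolanGrady q (A q) (B q) := by
  constructor
  · have := RingQuot.mkAlgHom_rel F (DolanGradyRel.rel₁ (q := q) _ _ rfl rfl)
    simp only [map_sub, map_add, map_smul, map_mul, map_pow] at this
    exact this
  · have := RingQuot.mkAlgHom_rel F (DolanGradyRel.rel₂ (q := q) _ _ rfl rfl)
    simp only [map_sub, map_add, map_smul, map_mul, map_pow] at this
    exact this

theorem C_eq_qBracket (q : F) : C q = qBracket q (A q) (B q) := rfl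

section Lift

variable {R : Type*} [Ring R] [Algebra F R] {x y : R}

/-- The algebra homomorphism out of `O_q` determined by a Dolan/Grady pair. -/
noncomputable def lift (h : IsDolanGrady q x y) : QOnsager q →ₐ[F] R :=
  RingQuot.liftAlgHom F ⟨FreeAlgebra.lift F ![x, y], by
    rintro _ _ (⟨_, _, rfl, rfl⟩ | ⟨_, _, rfl, rfl⟩)
    · simpa only [map_sub, map_add, map_smul, map_mul, map_pow, FreeAlgebra.lift_ι_apply,
        Matrix.cons_val_zero, Matrix.cons_val_one] using h.rel₁
    · simpa only [map_sub, map_add, map_smul, map_mul, map_pow, FreeAlgebra.lift_ι_apply,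
        Matrix.cons_val_zero, Matrix.cons_val_one] using h.rel₂⟩

@[simp]
theorem lift_A (h : IsDolanGrady q x y) : lift h (A q) = x := by
  rw [lift, A, RingQuot.liftAlgHom_mkAlgHom_apply]
  simp

@[simp]
theorem lift_B (h : IsDolanGrady q x y) : lift h (B q) = y := by
  rw [lift, B, RingQuot.liftAlgHom_mkAlgHom_apply]
  simp

end Lift

/-- Induction on the generators of `O_q`. -/
theorem induction {P : QOnsager q → Prop} (hA : P (A q)) (hB : P (B q)) (h1 : P 1)
    (hsmul : ∀ (r : F) x, P x → P (r • x)) (hadd : ∀ x y, P x → P y → P (x + y))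
    (hmul : ∀ x y, P x → P y → P (x * y)) (x : QOnsager q) : P x := by
  obtain ⟨z, rfl⟩ := RingQuot.mkAlgHom_surjective F (DolanGradyRel q) x
  induction z using FreeAlgebra.induction with
  | grade0 r =>
    rw [AlgHom.commutes, Algebra.algebraMap_eq_smul_one]
    exact hsmul r 1 h1
  | grade1 i =>
    fin_cases i
    · exact hA
    · exact hB
  | mul x y hx hy =>
    rw [map_mul]
    exact hmul _ _ hx hy
  | add x y hx hy =>
    rw [map_add]
    exact hadd _ _ hx hy

section AntiLift

variable {x y : QOnsager q}

/-- The antihomomorphism `O_q → O_q` determined by a Dolan/Grady pair of `O_q`. -/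
noncomputable def antiLift (h : IsDolanGrady q x y) : QOnsager q →ₗ[F] QOnsager q :=
  (MulOpposite.opLinearEquiv F).symm.toLinearMap ∘ₗ
    (lift (isDolanGrady_op_iff.2 h)).toLinearMap

theorem antiLift_mul (h : IsDolanGrady q x y) (z w : QOnsager q) :
    antiLift h (z * w) = antiLift h w * antiLift h z := by
  simp [antiLift]

theorem antiLift_one (h : IsDolanGrady q x y) : antiLift h 1 = 1 := by
  simp [antiLift]

@[simp]
theorem antiLift_A (h : IsDolanGrady q x y) : antiLift h (A q) = x := by
  simp [antiLift]

@[simp]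
theorem antiLift_B (h : IsDolanGrady q x y) : antiLift h (B q) = y := by
  simp [antiLift]

theorem antiLift_C (h : IsDolanGrady q x y) : antiLift h (C q) = qBracket q y x := by
  simp [C, qBracket, antiLift_mul]

theorem antiLift_involutive (h : IsDolanGrady q x y) (hx : antiLift h x = A q)
    (hy : antiLift h y = B q) : Function.Involutive (antiLift h) := by
  intro z
  induction z using induction with
  | hA => rw [antiLift_A, hx]
  | hB => rw [antiLift_B, hy]
  | h1 => rw [antiLift_one, antiLift_one]
  | hsmul r z hz => rw [map_smul, map_smul, hz]
  | hadd z w hz hw => rw [map_add, map_add, hz, hw]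
  | hmul z w hz hw => rw [antiLift_mul, antiLift_mul, hz, hw]

/-- An involutive antiautomorphism of `O_q`. -/
noncomputable def antiInvolution (h : IsDolanGrady q x y) (hx : antiLift h x = A q)
    (hy : antiLift h y = B q) : AAut F (QOnsager q) :=
  ⟨LinearEquiv.ofInvolutive (antiLift h) (antiLift_involutive h hx hy),
    Or.inr (antiLift_mul h)⟩

variable (h : IsDolanGrady q x y) (hx : antiLift h x = A q) (hy : antiLift h y = B q)

theorem antiInvolution_apply (z : QOnsager q) :
    (antiInvolution h hx hy).1 z = antiLift h z := rfl

theorem antiInvolution_mul_self :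
    antiInvolution h hx hy * antiInvolution h hx hy = 1 :=
  Subtype.ext (LinearEquiv.ext (antiLift_involutive h hx hy))

end AntiLift

/-! ## The three reflections -/

/-- The antiautomorphism of `O_q` fixing `A` and `B`. -/
noncomputable def reflC (q : F) : AAut F (QOnsager q) :=
  antiInvolution (isDolanGrady q) (antiLift_A _) (antiLift_B _)

section Reflections

variable (hq : q ≠ 0) (hroot : ∀ n : ℕ, 0 < n → q ^ n ≠ 1)

include hq hroot in
theorem isDolanGrady_reflB : IsDolanGrady q (A q)
    (B q + (q - q⁻¹)⁻¹ • (C q * A q - A q * C q)) :=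
  (isDolanGrady q).lusztigMove hq hroot

theorem antiLift_reflB_C : antiLift (isDolanGrady_reflB hq hroot) (C q) = C q := by
  rw [antiLift_C]
  exact (isDolanGrady q).qBracket_lusztigMove hq hroot

/-- The antiautomorphism of `O_q` fixing `A` and `C`. -/
noncomputable def reflB : AAut F (QOnsager q) :=
  antiInvolution (isDolanGrady_reflB hq hroot) (antiLift_A _) (by
    -- Fixing `A` and `C` while reversing products negates `[C, A]`, so the two corrections to `B`
    -- cancel.
    rw [map_add, map_smul, map_sub, antiLift_mul, antiLift_mul, antiLift_reflB_C hq hroot, antiLift_A,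
      antiLift_B, add_assoc, ← smul_add, sub_add_sub_cancel, sub_self, smul_zero, add_zero])

/-- Passing to the opposite algebra with `A` and `B` exchanged preserves `C`, so all facts about the
move of `A` follow from those about the move of `B`. -/
theorem lusztigMove_op : lusztigMove q (MulOpposite.op (B q)) (MulOpposite.op (A q)) =
    MulOpposite.op (A q + (q - q⁻¹)⁻¹ • (B q * C q - C q * B q)) := rfl

include hq hroot in
theorem isDolanGrady_reflA : IsDolanGrady q
    (A q + (q - q⁻¹)⁻¹ • (B q * C q - C q * B q)) (B q) := by
  rw [← isDolanGrady_op_iff, ← lusztigMove_op]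
  exact ((isDolanGrady_op_iff.2 (isDolanGrady q)).swap.lusztigMove hq hroot).swap

theorem antiLift_reflA_C : antiLift (isDolanGrady_reflA hq hroot) (C q) = C q := by
  rw [antiLift_C]
  have := (isDolanGrady_op_iff.2 (isDolanGrady q)).swap.qBracket_lusztigMove hq hroot
  rw [lusztigMove_op] at this
  exact congrArg MulOpposite.unop this

/-- The antiautomorphism of `O_q` fixing `B` and `C`. -/
noncomputable def reflA : AAut F (QOnsager q) :=
  antiInvolution (isDolanGrady_reflA hq hroot) (by
    rw [map_add, map_smul, map_sub, antiLift_mul, antiLift_mul, antiLift_reflA_C hq hroot, antiLift_A,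
      antiLift_B, add_assoc, ← smul_add, sub_add_sub_cancel, sub_self, smul_zero, add_zero])
    (antiLift_B _)

include hq hroot in
theorem reflC_C : (reflC q).1 (C q) = C q + (q - q⁻¹)⁻¹ • (A q * B q - B q * A q) := by
  have hk := sub_inv_ne_zero_of_not_root hq hroot
  have hu := sq_sub_inv_sq_ne_zero_of_not_root hq hroot
  rw [reflC, antiInvolution_apply, antiLift_C, ← sub_eq_zero,
    ← smul_eq_zero_iff_right (mul_ne_zero hk hu)]
  have h₁ := smul_qBracket hu (A q) (B q)
  have h₂ := smul_qBracket hu (B q) (A q)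
  rw [← C_eq_qBracket] at h₁
  have h₃ := smul_inv_smul₀ hk (A q * B q - B q * A q)
  generalize (q - q⁻¹)⁻¹ • (A q * B q - B q * A q) = D at h₃ ⊢
  linear_combination (norm := skip) (q - q⁻¹) • h₂ - (q - q⁻¹) • h₁ - (q ^ 2 - q⁻¹ ^ 2) • h₃
  match_scalars <;> field_simp <;> ring

/-! ### The action of the free product and its image. -/

/-- The homomorphism from the group of order two determined by an involution. -/
def _root_.involutionHom {G : Type*} [Group G] (g : G) (hg : g * g = 1) :
    Multiplicative (ZMod 2) →* G where
  toFun x := g ^ x.toAdd.val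
  map_one' := pow_zero g
  map_mul' x y := by
    rw [← pow_add, toAdd_mul, ZMod.val_add, ← pow_mod_orderOf, ← pow_mod_orderOf g (_ + _),
      Nat.mod_mod_of_dvd]
    rw [orderOf_dvd_iff_pow_eq_one, pow_two, hg]

@[simp]
theorem _root_.involutionHom_one {G : Type*} [Group G] (g : G) (hg : g * g = 1) :
    involutionHom g hg (Multiplicative.ofAdd 1) = g :=
  pow_one g

theorem _root_.eq_ofAdd_one_of_ne_one {x : Multiplicative (ZMod 2)} (hx : x ≠ 1) :
    x = Multiplicative.ofAdd 1 := by
  revert x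
  decide

theorem reflA_mul_self : reflA hq hroot * reflA hq hroot = 1 := antiInvolution_mul_self _ _ _

theorem reflB_mul_self : reflB hq hroot * reflB hq hroot = 1 := antiInvolution_mul_self _ _ _

theorem reflC_mul_self (q : F) : reflC q * reflC q = 1 := antiInvolution_mul_self _ _ _

/-- The three reflections, as homomorphisms from the free factors. -/
noncomputable def reflHom : Fin 3 → Multiplicative (ZMod 2) →* AAut F (QOnsager q) :=
  ![involutionHom (reflA hq hroot) (reflA_mul_self hq hroot),
    involutionHom (reflB hq hroot) (reflB_mul_self hq hroot),
    involutionHom (reflC q) (reflC_mul_self q)]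

/-- The action of the free product on `O_q`. -/
noncomputable def action : FreeProductZ₂ →* AAut F (QOnsager q) :=
  Monoid.CoprodI.lift (reflHom hq hroot)

theorem action_a : action hq hroot FreeProductZ₂.a = reflA hq hroot := by
  rw [action, FreeProductZ₂.a, Monoid.CoprodI.lift_of]
  exact involutionHom_one _ (reflA_mul_self hq hroot)

theorem action_b : action hq hroot FreeProductZ₂.b = reflB hq hroot := by
  rw [action, FreeProductZ₂.b, Monoid.CoprodI.lift_of]
  exact involutionHom_one _ (reflB_mul_self hq hroot)

theorem action_c : action hq hroot FreeProductZ₂.c = reflC q := by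
  rw [action, FreeProductZ₂.c, Monoid.CoprodI.lift_of]
  exact involutionHom_one _ (reflC_mul_self q)

theorem action_range : (action hq hroot).range =
    Subgroup.closure {reflC q, reflB hq hroot * reflC q, reflC q * reflA hq hroot} := by
  apply le_antisymm
  · have hS : reflC q ∈ Subgroup.closure
        {reflC q, reflB hq hroot * reflC q, reflC q * reflA hq hroot} :=
      Subgroup.subset_closure (by simp)
    have hT₀ : reflB hq hroot * reflC q ∈ Subgroup.closure
        {reflC q, reflB hq hroot * reflC q, reflC q * reflA hq hroot} :=
      Subgroup.subset_closure (by simp)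
    have hT₁ : reflC q * reflA hq hroot ∈ Subgroup.closure
        {reflC q, reflB hq hroot * reflC q, reflC q * reflA hq hroot} :=
      Subgroup.subset_closure (by simp)
    have hA := Subgroup.mul_mem _ hS hT₁
    have hB := Subgroup.mul_mem _ hT₀ hS
    rw [← mul_assoc, reflC_mul_self, one_mul] at hA
    rw [mul_assoc, reflC_mul_self, mul_one] at hB
    refine Monoid.CoprodI.lift_range_le _ _ fun i => ?_
    rintro _ ⟨x, rfl⟩
    fin_cases i
    · exact Subgroup.pow_mem _ hA _
    · exact Subgroup.pow_mem _ hB _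
    · exact Subgroup.pow_mem _ hS _
  · rw [Subgroup.closure_le]
    rintro _ (rfl | rfl | rfl)
    · exact ⟨_, action_c hq hroot⟩
    · exact ⟨FreeProductZ₂.b * FreeProductZ₂.c, by rw [map_mul, action_b, action_c]⟩
    · exact ⟨FreeProductZ₂.c * FreeProductZ₂.a, by rw [map_mul, action_c, action_a]⟩

theorem isBaseilhacKolbT₀ : IsBaseilhacKolbT₀ q (reflB hq hroot * reflC q).1 := by
  refine ⟨fun x y => ?_, ?_, ?_⟩
  · change antiLift (isDolanGrady_reflB hq hroot) (antiLift (isDolanGrady q) (x * y)) =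
      antiLift (isDolanGrady_reflB hq hroot) (antiLift (isDolanGrady q) x) *
        antiLift (isDolanGrady_reflB hq hroot) (antiLift (isDolanGrady q) y)
    rw [antiLift_mul, antiLift_mul]
  · change antiLift (isDolanGrady_reflB hq hroot) (antiLift (isDolanGrady q) _) = _
    rw [antiLift_A, antiLift_A]
  · change antiLift (isDolanGrady_reflB hq hroot) (antiLift (isDolanGrady q) _) = _
    rw [antiLift_B, antiLift_B, C]
    congr 1
    rw [mul_inv, mul_smul]
    congr 1
    simp only [pow_two, mul_sub, sub_mul, smul_sub, smul_mul_assoc, mul_smul_comm, mul_assoc]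
    module

theorem isBaseilhacKolbT₁ : IsBaseilhacKolbT₁ q (reflC q * reflA hq hroot).1 := by
  refine ⟨fun x y => ?_, ?_, ?_⟩
  · change antiLift (isDolanGrady q) (antiLift (isDolanGrady_reflA hq hroot) (x * y)) =
      antiLift (isDolanGrady q) (antiLift (isDolanGrady_reflA hq hroot) x) *
        antiLift (isDolanGrady q) (antiLift (isDolanGrady_reflA hq hroot) y)
    rw [antiLift_mul, antiLift_mul]
  · change antiLift (isDolanGrady q) (antiLift (isDolanGrady_reflA hq hroot) _) = _
    rw [antiLift_B, antiLift_B]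
  · change antiLift (isDolanGrady q) (antiLift (isDolanGrady_reflA hq hroot) _) = _
    rw [antiLift_A, map_add, antiLift_A, map_smul, map_sub, antiLift_mul, antiLift_mul, antiLift_C,
      antiLift_B, qBracket]
    congr 1
    rw [mul_inv, mul_smul]
    congr 1
    simp only [pow_two, mul_sub, sub_mul, smul_sub, smul_mul_assoc, mul_smul_comm, mul_assoc]
    module

end Reflections

end QOnsager

/-! ## The quantum torus -/

/-- The quantum torus: the `F`-vector space with basis `e v`, `v ∈ ℤ²`, and the multiplication
`e v * e w = q ^ det (v, w) e (v + w)`. -/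
def QTorus {F : Type*} [Field F] (_q : Fˣ) : Type _ := ℤ × ℤ →₀ F

namespace QTorus

variable {F : Type*} [Field F] {q : Fˣ}

noncomputable instance (q : Fˣ) : AddCommGroup (QTorus q) :=
  inferInstanceAs (AddCommGroup (ℤ × ℤ →₀ F))

noncomputable instance (q : Fˣ) : Module F (QTorus q) :=
  inferInstanceAs (Module F (ℤ × ℤ →₀ F))

/-- The determinant of two integer vectors. -/
def det (v w : ℤ × ℤ) : ℤ := v.1 * w.2 - v.2 * w.1

/-- The basis vectors of the quantum torus. -/
noncomputable def e (q : Fˣ) (v : ℤ × ℤ) : QTorus q := Finsupp.single v 1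

theorem induction {P : QTorus q → Prop} (he : ∀ v, P (e q v))
    (hadd : ∀ x y, P x → P y → P (x + y)) (hsmul : ∀ (r : F) x, P x → P (r • x))
    (x : QTorus q) : P x := by
  refine Finsupp.induction_linear x ?_ hadd fun v r => ?_
  · have := hsmul 0 _ (he 0)
    rwa [zero_smul] at this
  · have := hsmul r _ (he v)
    have h : r • e q v = (Finsupp.single v r : ℤ × ℤ →₀ F) :=
      (Finsupp.smul_single r v (1 : F)).trans (by rw [smul_eq_mul, mul_one])
    exact h ▸ this

/-- The linear map with prescribed values on the basis vectors. -/
noncomputable def extend {M : Type*} [AddCommGroup M] [Module F M] (q : Fˣ) (f : ℤ × ℤ → M) :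
    QTorus q →ₗ[F] M :=
  Finsupp.linearCombination F f

@[simp]
theorem extend_e {M : Type*} [AddCommGroup M] [Module F M] (f : ℤ × ℤ → M) (v : ℤ × ℤ) :
    extend q f (e q v) = f v :=
  (Finsupp.linearCombination_single F 1 v).trans (one_smul F _)

/-- The bilinear multiplication of the quantum torus. -/
noncomputable def mulHom (q : Fˣ) : QTorus q →ₗ[F] QTorus q →ₗ[F] QTorus q :=
  extend q fun v => extend q fun w => ((q ^ det v w : Fˣ) : F) • e q (v + w)

theorem mulHom_e (v w : ℤ × ℤ) :
    mulHom q (e q v) (e q w) = ((q ^ det v w : Fˣ) : F) • e q (v + w) := by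
  simp [mulHom]

theorem mulHom_one_left (x : QTorus q) : mulHom q (e q 0) x = x := by
  induction x using induction with
  | he v => simp [mulHom_e, det]
  | hadd x y hx hy => rw [map_add, hx, hy]
  | hsmul r x hx => rw [map_smul, hx]

theorem mulHom_one_right (x : QTorus q) : mulHom q x (e q 0) = x := by
  induction x using induction with
  | he v => simp [mulHom_e, det]
  | hadd x y hx hy => rw [map_add, LinearMap.add_apply, hx, hy]
  | hsmul r x hx => rw [map_smul, LinearMap.smul_apply, hx]

/-- Bilinearity of the determinant makes `q ^ det` a 2-cocycle. -/
theorem mulHom_assoc (x y z : QTorus q) :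
    mulHom q (mulHom q x y) z = mulHom q x (mulHom q y z) := by
  induction x using induction with
  | hadd x₁ x₂ h₁ h₂ => simp only [map_add, LinearMap.add_apply, h₁, h₂]
  | hsmul r x h => simp only [map_smul, LinearMap.smul_apply, h]
  | he v =>
    induction y using induction with
    | hadd y₁ y₂ h₁ h₂ => simp only [map_add, LinearMap.add_apply, h₁, h₂]
    | hsmul r y h => simp only [map_smul, LinearMap.smul_apply, h]
    | he w =>
      induction z using induction with
      | hadd z₁ z₂ h₁ h₂ => simp only [map_add, h₁, h₂]
      | hsmul r z h => simp only [map_smul, h]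
      | he t =>
        simp only [mulHom_e, map_smul, LinearMap.smul_apply, smul_smul, ← Units.val_mul,
          ← zpow_add, add_assoc]
        congr 3
        simp only [det, Prod.fst_add, Prod.snd_add]
        ring_nf

noncomputable instance (q : Fˣ) : Ring (QTorus q) where
  mul x y := mulHom q x y
  one := e q 0
  mul_assoc := mulHom_assoc
  one_mul := mulHom_one_left
  mul_one := mulHom_one_right
  left_distrib x y z := map_add (mulHom q x) y z
  right_distrib x y z := LinearMap.map_add₂ (mulHom q) x y z
  zero_mul x := LinearMap.map_zero₂ (mulHom q) x
  mul_zero x := map_zero (mulHom q x)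
  zsmul := (· • ·)
  zsmul_zero' := zero_zsmul
  zsmul_succ' := SubNegMonoid.zsmul_succ'
  zsmul_neg' := SubNegMonoid.zsmul_neg'
  neg_add_cancel := neg_add_cancel
  sub_eq_add_neg := sub_eq_add_neg

theorem one_def (q : Fˣ) : (1 : QTorus q) = e q 0 := rfl

noncomputable instance (q : Fˣ) : Algebra F (QTorus q) :=
  Algebra.ofModule (fun r x y => LinearMap.map_smul₂ (mulHom q) r x y)
    (fun r x y => map_smul (mulHom q x) r y)

theorem e_mul_e (v w : ℤ × ℤ) : e q v * e q w = ((q ^ det v w : Fˣ) : F) • e q (v + w) :=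
  mulHom_e v w

/-! ### Symmetrized monomials as a Dolan/Grady pair. -/

/-- The symmetrized basis vectors. -/
noncomputable def E (q : Fˣ) (v : ℤ × ℤ) : QTorus q := e q v + e q (-v)

theorem E_neg (v : ℤ × ℤ) : E q (-v) = E q v := by
  rw [E, E, neg_neg, add_comm]

theorem E_mul_E (v w : ℤ × ℤ) : E q v * E q w =
    ((q ^ det v w : Fˣ) : F) • E q (v + w) + ((q ^ (-det v w) : Fˣ) : F) • E q (v - w) := by
  have h₁ : det v (-w) = -det v w := by simp only [det, Prod.fst_neg, Prod.snd_neg]; ring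
  have h₂ : det (-v) w = -det v w := by simp only [det, Prod.fst_neg, Prod.snd_neg]; ring
  have h₃ : det (-v) (-w) = det v w := by simp only [det, Prod.fst_neg, Prod.snd_neg]; ring
  simp only [E, add_mul, mul_add, e_mul_e, h₁, h₂, h₃, smul_add]
  rw [show -(v + w) = -v + -w by abel, show -(v - w) = -v + w by abel, sub_eq_add_neg]
  abel

/-- Compare the coefficients at `v`: on the left it is `1`, since `v ≠ -v`, in every characteristic.
-/
theorem E_injective_up_to_sign {v w : ℤ × ℤ} (hv : v ≠ 0) (h : E q v = E q w) :
    v = w ∨ v = -w := by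
  by_contra! hvw
  have h' := DFunLike.congr_fun (F := ℤ × ℤ →₀ F) h v
  change (Finsupp.single v (1 : F) + Finsupp.single (-v) (1 : F) : ℤ × ℤ →₀ F) v =
    (Finsupp.single w (1 : F) + Finsupp.single (-w) (1 : F) : ℤ × ℤ →₀ F) v at h'
  rw [Finsupp.add_apply, Finsupp.add_apply, Finsupp.single_eq_same,
    Finsupp.single_eq_of_ne hvw.1, Finsupp.single_eq_of_ne hvw.2,
    Finsupp.single_eq_of_ne (self_ne_neg.mpr hv), add_zero, add_zero] at h'
  exact one_ne_zero h'

/-- The antiautomorphism of the quantum torus induced by a determinant-reversing linear map. -/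
noncomputable def reflect (q : Fˣ) (m : ℤ × ℤ →+ ℤ × ℤ) : QTorus q →ₗ[F] QTorus q :=
  extend q fun v => e q (m v)

/-- Reversing the sign of the determinant turns the factor of `e v * e w` into that of the product
of the images in the opposite order. -/
theorem reflect_mul {m : ℤ × ℤ →+ ℤ × ℤ} (hm : ∀ v w, det (m v) (m w) = det w v)
    (x y : QTorus q) : reflect q m (x * y) = reflect q m y * reflect q m x := by
  induction x using induction with
  | hadd x₁ x₂ h₁ h₂ => simp only [map_add, add_mul, mul_add, h₁, h₂]
  | hsmul r x h => simp only [map_smul, smul_mul_assoc, mul_smul_comm, h]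
  | he v =>
    induction y using induction with
    | hadd y₁ y₂ h₁ h₂ => simp only [map_add, add_mul, mul_add, h₁, h₂]
    | hsmul r y h => simp only [map_smul, smul_mul_assoc, mul_smul_comm, h]
    | he w =>
      simp only [e_mul_e, map_smul, reflect, extend_e, hm, map_add]
      rw [add_comm]

theorem reflect_one (m : ℤ × ℤ →+ ℤ × ℤ) : reflect q m 1 = 1 := by
  simp [one_def, reflect]

theorem reflect_E (m : ℤ × ℤ →+ ℤ × ℤ) (v : ℤ × ℤ) : reflect q m (E q v) = E q (m v) := by
  simp [E, reflect]

theorem E_10_mul_E_01 : E q (1, 0) * E q (0, 1) =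
    (q : F) • E q (1, 1) + (q : F)⁻¹ • E q (1, -1) := by
  rw [E_mul_E]
  simp [det]

theorem E_01_mul_E_10 : E q (0, 1) * E q (1, 0) =
    (q : F)⁻¹ • E q (1, 1) + (q : F) • E q (1, -1) := by
  rw [E_mul_E, ← E_neg ((0, 1) - (1, 0))]
  simp [det]

theorem E_11_mul_E_10 : E q (1, 1) * E q (1, 0) =
    (q : F)⁻¹ • E q (2, 1) + (q : F) • E q (0, 1) := by
  rw [E_mul_E]
  simp [det]

theorem E_10_mul_E_11 : E q (1, 0) * E q (1, 1) =
    (q : F) • E q (2, 1) + (q : F)⁻¹ • E q (0, 1) := by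
  rw [E_mul_E, ← E_neg ((1, 0) - (1, 1))]
  simp [det]

theorem E_01_mul_E_11 : E q (0, 1) * E q (1, 1) =
    (q : F)⁻¹ • E q (1, 2) + (q : F) • E q (1, 0) := by
  rw [E_mul_E, ← E_neg ((0, 1) - (1, 1))]
  simp [det]

theorem E_11_mul_E_01 : E q (1, 1) * E q (0, 1) =
    (q : F) • E q (1, 2) + (q : F)⁻¹ • E q (1, 0) := by
  rw [E_mul_E]
  simp [det]

theorem E_21_mul_E_10 : E q (2, 1) * E q (1, 0) =
    (q : F)⁻¹ • E q (3, 1) + (q : F) • E q (1, 1) := by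
  rw [E_mul_E]
  simp [det]

theorem E_10_mul_E_21 : E q (1, 0) * E q (2, 1) =
    (q : F) • E q (3, 1) + (q : F)⁻¹ • E q (1, 1) := by
  rw [E_mul_E, ← E_neg ((1, 0) - (2, 1))]
  simp [det]

theorem E_01_mul_E_12 : E q (0, 1) * E q (1, 2) =
    (q : F)⁻¹ • E q (1, 3) + (q : F) • E q (1, 1) := by
  rw [E_mul_E, ← E_neg ((0, 1) - (1, 2))]
  simp [det]

theorem E_12_mul_E_01 : E q (1, 2) * E q (0, 1) =
    (q : F) • E q (1, 3) + (q : F)⁻¹ • E q (1, 1) := by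
  rw [E_mul_E]
  simp [det]

/-- The coefficients of `E (1, -1)` cancel in `q⁻¹ B A - q A B`. -/
theorem qBracket_E (hu : (q : F) ^ 2 - (q : F)⁻¹ ^ 2 ≠ 0) :
    qBracket (q : F) (E q (1, 0)) (E q (0, 1)) = -E q (1, 1) := by
  rw [← sub_eq_zero, ← smul_eq_zero_iff_right hu]
  have h := smul_qBracket hu (E q (1, 0)) (E q (0, 1))
  generalize qBracket (q : F) (E q (1, 0)) (E q (0, 1)) = D at h ⊢
  rw [E_10_mul_E_01, E_01_mul_E_10] at h
  linear_combination (norm := skip) h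
  match_scalars <;> field_simp <;> ring

theorem commutator_CA : -E q (1, 1) * E q (1, 0) - E q (1, 0) * -E q (1, 1) =
    ((q : F) - (q : F)⁻¹) • (E q (2, 1) - E q (0, 1)) := by
  rw [neg_mul, mul_neg, E_11_mul_E_10, E_10_mul_E_11]
  module

theorem commutator_BC : E q (0, 1) * -E q (1, 1) - -E q (1, 1) * E q (0, 1) =
    ((q : F) - (q : F)⁻¹) • (E q (1, 2) - E q (1, 0)) := by
  rw [neg_mul, mul_neg, E_11_mul_E_01, E_01_mul_E_11]
  module

theorem isDolanGrady_E (hk : (q : F) - (q : F)⁻¹ ≠ 0) (hu : (q : F) ^ 2 - (q : F)⁻¹ ^ 2 ≠ 0) :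
    IsDolanGrady (q : F) (E q (1, 0)) (E q (0, 1)) := by
  have hC := smul_qBracket hu (E q (1, 0)) (E q (0, 1))
  rw [qBracket_E hu] at hC
  have hq : (q : F) ≠ 0 := q.ne_zero
  constructor
  · rw [dolanGrady_rel₁_iff hq hk hu hC, commutator_CA]
    simp only [smul_mul_assoc, mul_smul_comm, sub_mul, mul_sub, E_10_mul_E_01, E_01_mul_E_10,
      E_21_mul_E_10, E_10_mul_E_21]
    match_scalars <;> field_simp <;> ring
  · rw [dolanGrady_rel₂_iff hq hk hu hC, commutator_BC]
    simp only [smul_mul_assoc, mul_smul_comm, sub_mul, mul_sub, E_10_mul_E_01, E_01_mul_E_10,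
      E_12_mul_E_01, E_01_mul_E_12]
    match_scalars <;> field_simp <;> ring

end QTorus

/-! ## Faithfulness of the action -/

namespace QOnsager

variable {F : Type*} [Field F] {q : F} (hq : q ≠ 0) (hroot : ∀ n : ℕ, 0 < n → q ^ n ≠ 1)

/-- The homomorphism from `O_q` to the quantum torus. -/
noncomputable def toTorus : QOnsager q →ₐ[F] QTorus (Units.mk0 q hq) :=
  lift (q := q) (QTorus.isDolanGrady_E (q := Units.mk0 q hq) (sub_inv_ne_zero_of_not_root hq hroot)
    (sq_sub_inv_sq_ne_zero_of_not_root hq hroot))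

theorem toTorus_A : toTorus hq hroot (A q) = QTorus.E _ (1, 0) := lift_A _

theorem toTorus_B : toTorus hq hroot (B q) = QTorus.E _ (0, 1) := lift_B _

theorem toTorus_C : toTorus hq hroot (C q) = -QTorus.E _ (1, 1) := by
  rw [← QTorus.qBracket_E (sq_sub_inv_sq_ne_zero_of_not_root hq hroot), C]
  simp only [map_smul, map_sub, map_mul, toTorus_A, toTorus_B]
  rfl

theorem toTorus_reflA_A : toTorus hq hroot (A q + (q - q⁻¹)⁻¹ • (B q * C q - C q * B q)) =
    QTorus.E _ (1, 2) := by
  have h := QTorus.commutator_BC (q := Units.mk0 q hq)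
  rw [Units.val_mk0] at h
  rw [map_add, map_smul, map_sub, map_mul, map_mul, toTorus_A, toTorus_B, toTorus_C, h,
    inv_smul_smul₀ (sub_inv_ne_zero_of_not_root hq hroot), add_sub_cancel]

theorem toTorus_reflB_B : toTorus hq hroot (B q + (q - q⁻¹)⁻¹ • (C q * A q - A q * C q)) =
    QTorus.E _ (2, 1) := by
  have h := QTorus.commutator_CA (q := Units.mk0 q hq)
  rw [Units.val_mk0] at h
  rw [map_add, map_smul, map_sub, map_mul, map_mul, toTorus_A, toTorus_B, toTorus_C, h,
    inv_smul_smul₀ (sub_inv_ne_zero_of_not_root hq hroot), add_sub_cancel]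

/-- Both sides reverse products and are linear in `z`, so agreement on the generators suffices. -/
theorem toTorus_antiLift {x y : QOnsager q} (h : IsDolanGrady q x y) {m : ℤ × ℤ →+ ℤ × ℤ}
    (hm : ∀ v w, QTorus.det (m v) (m w) = QTorus.det w v)
    (hx : toTorus hq hroot x = QTorus.E _ (m (1, 0)))
    (hy : toTorus hq hroot y = QTorus.E _ (m (0, 1))) (z : QOnsager q) :
    toTorus hq hroot (antiLift h z) = QTorus.reflect _ m (toTorus hq hroot z) := by
  induction z using induction with
  | hA => rw [antiLift_A, toTorus_A, QTorus.reflect_E, hx]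
  | hB => rw [antiLift_B, toTorus_B, QTorus.reflect_E, hy]
  | h1 => rw [antiLift_one, map_one, QTorus.reflect_one]
  | hsmul r z hz => rw [map_smul, map_smul, map_smul, map_smul, hz]
  | hadd z w hz hw => rw [map_add, map_add, map_add, map_add, hz, hw]
  | hmul z w hz hw => rw [antiLift_mul, map_mul, map_mul, QTorus.reflect_mul hm, hz, hw]

/-! ### Lattice reflections and ping-pong. -/

/-- The linear reflections of `ℤ²` in the sides of the ideal triangle with vertices
`(1, 0)`, `(0, 1)`, `(1, 1)`. -/
def latticeReflection : Fin 3 → ℤ × ℤ →+ ℤ × ℤ :=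
  ![AddMonoidHom.mk' (fun v => (-v.1, v.2 - 2 * v.1)) (fun v w => by
      exact Prod.ext (by simp only [Prod.fst_add, Prod.snd_add]; ring)
        (by simp only [Prod.fst_add, Prod.snd_add]; ring)),
    AddMonoidHom.mk' (fun v => (v.1 - 2 * v.2, -v.2)) (fun v w => by
      exact Prod.ext (by simp only [Prod.fst_add, Prod.snd_add]; ring)
        (by simp only [Prod.fst_add, Prod.snd_add]; ring)),
    AddMonoidHom.mk' (fun v => (v.1, -v.2)) (fun v w => by
      exact Prod.ext rfl
        (by simp only [Prod.fst_add, Prod.snd_add]; ring))]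

theorem latticeReflection_zero (v : ℤ × ℤ) :
    latticeReflection 0 v = (-v.1, v.2 - 2 * v.1) := rfl

theorem latticeReflection_one (v : ℤ × ℤ) :
    latticeReflection 1 v = (v.1 - 2 * v.2, -v.2) := rfl

theorem latticeReflection_two (v : ℤ × ℤ) : latticeReflection 2 v = (v.1, -v.2) := rfl

theorem det_latticeReflection (i : Fin 3) (v w : ℤ × ℤ) :
    QTorus.det (latticeReflection i v) (latticeReflection i w) = QTorus.det w v := by
  fin_cases i
  · change QTorus.det (-v.1, v.2 - 2 * v.1) (-w.1, w.2 - 2 * w.1) = _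
    simp only [QTorus.det]
    ring
  · change QTorus.det (v.1 - 2 * v.2, -v.2) (w.1 - 2 * w.2, -w.2) = _
    simp only [QTorus.det]
    ring
  · change QTorus.det (v.1, -v.2) (w.1, -w.2) = _
    simp only [QTorus.det]
    ring

/-- The regions of `ℤ²` beyond the three sides of the ideal triangle. -/
def region : Fin 3 → Set (ℤ × ℤ) :=
  ![{v | 0 < v.1 * (v.2 - v.1)}, {v | 0 < v.2 * (v.1 - v.2)}, {v | v.1 * v.2 < 0}]

theorem mem_region_zero {v : ℤ × ℤ} : v ∈ region 0 ↔ 0 < v.1 * (v.2 - v.1) := Iff.rfl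

theorem mem_region_one {v : ℤ × ℤ} : v ∈ region 1 ↔ 0 < v.2 * (v.1 - v.2) := Iff.rfl

theorem mem_region_two {v : ℤ × ℤ} : v ∈ region 2 ↔ v.1 * v.2 < 0 := Iff.rfl

theorem neg_mem_region {i : Fin 3} {v : ℤ × ℤ} (hv : v ∈ region i) : -v ∈ region i := by
  fin_cases i
  · exact mem_region_zero.2 (by
      have := mem_region_zero.1 hv; simp only [Prod.fst_neg, Prod.snd_neg]; linarith)
  · exact mem_region_one.2 (by
      have := mem_region_one.1 hv; simp only [Prod.fst_neg, Prod.snd_neg]; linarith)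
  · exact mem_region_two.2 (by
      have := mem_region_two.1 hv; simp only [Prod.fst_neg, Prod.snd_neg]; linarith)

theorem zero_notMem_region (i : Fin 3) : (0 : ℤ × ℤ) ∉ region i := by
  fin_cases i <;> simp [region]

theorem region_disjoint {i j : Fin 3} (hij : i ≠ j) {v : ℤ × ℤ} (hi : v ∈ region i) :
    v ∉ region j := by
  intro hj
  have h01 : ¬(v ∈ region 0 ∧ v ∈ region 1) := by
    rw [mem_region_zero, mem_region_one]
    rintro ⟨h, h'⟩
    nlinarith [sq_nonneg (v.1 - v.2)]
  have h02 : ¬(v ∈ region 0 ∧ v ∈ region 2) := by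
    rw [mem_region_zero, mem_region_two]
    rintro ⟨h, h'⟩
    nlinarith [sq_nonneg v.1]
  have h12 : ¬(v ∈ region 1 ∧ v ∈ region 2) := by
    rw [mem_region_one, mem_region_two]
    rintro ⟨h, h'⟩
    nlinarith [sq_nonneg v.2]
  fin_cases i <;> fin_cases j
  · exact hij rfl
  · exact h01 ⟨hi, hj⟩
  · exact h02 ⟨hi, hj⟩
  · exact h01 ⟨hj, hi⟩
  · exact hij rfl
  · exact h12 ⟨hi, hj⟩
  · exact h02 ⟨hj, hi⟩
  · exact h12 ⟨hj, hi⟩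
  · exact hij rfl

/-- Region `i` is where a quadratic form is positive: `x (y - x)`, `y (x - y)` or `-x y`. Reflection
`i` negates its form, and that form is negative on the other two regions. -/
theorem latticeReflection_mem_region {i j : Fin 3} (hij : i ≠ j) {v : ℤ × ℤ}
    (hv : v ∈ region j) : latticeReflection i v ∈ region i := by
  have h0 : v ∈ region 1 ∨ v ∈ region 2 → latticeReflection 0 v ∈ region 0 := by
    rw [mem_region_zero, latticeReflection_zero, mem_region_one, mem_region_two]
    rintro (h | h) <;> nlinarith [sq_nonneg (v.1 - v.2), sq_nonneg v.1]
  have h1 : v ∈ region 0 ∨ v ∈ region 2 → latticeReflection 1 v ∈ region 1 := by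
    rw [mem_region_one, latticeReflection_one, mem_region_zero, mem_region_two]
    rintro (h | h) <;> nlinarith [sq_nonneg (v.1 - v.2), sq_nonneg v.2]
  have h2 : v ∈ region 0 ∨ v ∈ region 1 → latticeReflection 2 v ∈ region 2 := by
    rw [mem_region_two, latticeReflection_two, mem_region_zero, mem_region_one]
    rintro (h | h) <;> nlinarith [sq_nonneg v.1, sq_nonneg v.2]
  fin_cases i <;> fin_cases j
  · exact absurd rfl hij
  · exact h0 (Or.inl hv)
  · exact h0 (Or.inr hv)
  · exact h1 (Or.inl hv)
  · exact absurd rfl hij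
  · exact h1 (Or.inr hv)
  · exact h2 (Or.inl hv)
  · exact h2 (Or.inr hv)
  · exact absurd rfl hij

theorem toTorus_reflHom (i : Fin 3) {h : Multiplicative (ZMod 2)} (hh : h ≠ 1) (z : QOnsager q) :
    toTorus hq hroot ((reflHom hq hroot i h).1 z) =
      QTorus.reflect _ (latticeReflection i) (toTorus hq hroot z) := by
  rw [eq_ofAdd_one_of_ne_one hh]
  have hm := det_latticeReflection
  fin_cases i
  · have := toTorus_antiLift hq hroot (isDolanGrady_reflA hq hroot) (hm 0)
      -- The reflection sends `(1, 0)` to `(-1, -2)`; the sign is invisible to `E`.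
      (by rw [toTorus_reflA_A, ← QTorus.E_neg]; rfl) (by rw [toTorus_B]; rfl) z
    exact (congrArg (fun g : AAut F (QOnsager q) => toTorus hq hroot (g.1 z))
      (involutionHom_one _ (reflA_mul_self hq hroot))).trans this
  · have := toTorus_antiLift hq hroot (isDolanGrady_reflB hq hroot) (hm 1)
      (by rw [toTorus_A]; rfl) (by rw [toTorus_reflB_B, ← QTorus.E_neg]; rfl) z
    exact (congrArg (fun g : AAut F (QOnsager q) => toTorus hq hroot (g.1 z))
      (involutionHom_one _ (reflB_mul_self hq hroot))).trans this
  · have := toTorus_antiLift hq hroot (isDolanGrady q) (hm 2)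
      (by rw [toTorus_A]; rfl) (by rw [toTorus_B, ← QTorus.E_neg]; rfl) z
    exact (congrArg (fun g : AAut F (QOnsager q) => toTorus hq hroot (g.1 z))
      (involutionHom_one _ (reflC_mul_self q))).trans this

theorem exists_toTorus_eq_E (i : Fin 3) :
    ∃ z, ∃ v ∈ region i, toTorus hq hroot z = QTorus.E _ v := by
  fin_cases i
  · exact ⟨_, (1, 2), mem_region_zero.2 (by norm_num), toTorus_reflA_A hq hroot⟩
  · exact ⟨_, (2, 1), mem_region_one.2 (by norm_num), toTorus_reflB_B hq hroot⟩
  -- The generators and `-C` have images on the region boundaries; reflecting `(1, 1)`, the vector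
  -- of `-C`, gives `(1, -1)`.
  · refine ⟨(reflHom hq hroot 2 (Multiplicative.ofAdd 1)).1 (-C q), (1, -1),
      mem_region_two.2 (by norm_num), ?_⟩
    rw [toTorus_reflHom hq hroot 2 (by decide), map_neg, toTorus_C, neg_neg, QTorus.reflect_E]
    rfl

/-- The ping-pong is played in `O_q` itself, on preimages of the vectors `E v`, so injectivity of
`toTorus` is not needed. Disjointness survives the ambiguity `E v = E (-v)` because the regions are
symmetric and omit zero. -/
theorem action_injective : Function.Injective (action hq hroot) := by
  refine Monoid.CoprodI.lift_injective_of_ping_pong (reflHom hq hroot)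
    -- Ping-pong requires at least three factors or a factor with at least three elements; here
    -- there are three factors.
    (Or.inl (by simp))
    (fun i => {z : QOnsager q | ∃ v ∈ region i, toTorus hq hroot z = QTorus.E _ v})
    (exists_toTorus_eq_E hq hroot) ?_ ?_
  · intro i j hij
    rw [Function.onFun, Set.disjoint_left]
    rintro z ⟨v, hv, hz⟩ ⟨w, hw, hz'⟩
    rw [hz] at hz'
    have hv0 : v ≠ 0 := fun h => zero_notMem_region i (h ▸ hv)
    rcases QTorus.E_injective_up_to_sign hv0 hz' with rfl | rfl
    · exact region_disjoint hij hv hw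
    · exact region_disjoint hij hv (neg_mem_region hw)
  · intro i j hij h hh
    rintro _ ⟨z, ⟨v, hv, hz⟩, rfl⟩
    refine ⟨latticeReflection i v, latticeReflection_mem_region hij hv, ?_⟩
    change toTorus hq hroot ((reflHom hq hroot i h).1 z) = _
    rw [toTorus_reflHom hq hroot i hh, hz, QTorus.reflect_E]

end QOnsager

theorem theorem2p9 {F : Type*} [Field F] (q : F) (hq : q ≠ 0)
    (hroot : ∀ n : ℕ, 0 < n → q ^ n ≠ 1) :
    ∃ (T₀ T₁ S : AAut F (QOnsager q)) (ρ : FreeProductZ₂ →* AAut F (QOnsager q)),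
      -- `T₀`, `T₁` are the Baseilhac-Kolb automorphisms, `S` the antiautomorphism fixing `A`, `B`
      IsBaseilhacKolbT₀ q T₀.1 ∧
      IsBaseilhacKolbT₁ q T₁.1 ∧
      (IsAlgAntiaut S.1 ∧ S.1 (QOnsager.A q) = QOnsager.A q ∧
        S.1 (QOnsager.B q) = QOnsager.B q) ∧
      -- the action of `a`
      (IsAlgAntiaut (ρ FreeProductZ₂.a).1 ∧
        (ρ FreeProductZ₂.a).1 (QOnsager.A q) = QOnsager.A q + (q - q⁻¹)⁻¹ •
          (QOnsager.B q * QOnsager.C q - QOnsager.C q * QOnsager.B q) ∧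
        (ρ FreeProductZ₂.a).1 (QOnsager.B q) = QOnsager.B q ∧
        (ρ FreeProductZ₂.a).1 (QOnsager.C q) = QOnsager.C q) ∧
      -- the action of `b`
      (IsAlgAntiaut (ρ FreeProductZ₂.b).1 ∧
        (ρ FreeProductZ₂.b).1 (QOnsager.B q) = QOnsager.B q + (q - q⁻¹)⁻¹ •
          (QOnsager.C q * QOnsager.A q - QOnsager.A q * QOnsager.C q) ∧
        (ρ FreeProductZ₂.b).1 (QOnsager.C q) = QOnsager.C q ∧
        (ρ FreeProductZ₂.b).1 (QOnsager.A q) = QOnsager.A q) ∧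
      -- the action of `c`
      (IsAlgAntiaut (ρ FreeProductZ₂.c).1 ∧
        (ρ FreeProductZ₂.c).1 (QOnsager.C q) = QOnsager.C q + (q - q⁻¹)⁻¹ •
          (QOnsager.A q * QOnsager.B q - QOnsager.B q * QOnsager.A q) ∧
        (ρ FreeProductZ₂.c).1 (QOnsager.A q) = QOnsager.A q ∧
        (ρ FreeProductZ₂.c).1 (QOnsager.B q) = QOnsager.B q) ∧
      -- the generators in terms of `S`, `T₀`, `T₁`
      (ρ FreeProductZ₂.a = S * T₁ ∧ ρ FreeProductZ₂.a = T₁⁻¹ * S ∧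
        ρ FreeProductZ₂.b = T₀ * S ∧ ρ FreeProductZ₂.b = S * T₀⁻¹ ∧
        ρ FreeProductZ₂.c = S) ∧
      -- `T₀`, `T₁` and their inverses in terms of the generators
      (T₀ = ρ (FreeProductZ₂.b * FreeProductZ₂.c) ∧
        T₀⁻¹ = ρ (FreeProductZ₂.c * FreeProductZ₂.b) ∧
        T₁ = ρ (FreeProductZ₂.c * FreeProductZ₂.a) ∧
        T₁⁻¹ = ρ (FreeProductZ₂.a * FreeProductZ₂.c)) ∧
      -- the action is faithful, and its image is the group `G` generated by `S`, `T₀`, `T₁`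
      Function.Injective ρ ∧ ρ.range = Subgroup.closure {S, T₀, T₁} := by
  have hC := QOnsager.reflC_mul_self q
  have hA := QOnsager.reflA_mul_self hq hroot
  have hB := QOnsager.reflB_mul_self hq hroot
  have hC' := inv_eq_of_mul_eq_one_left hC
  have hA' := inv_eq_of_mul_eq_one_left hA
  have hB' := inv_eq_of_mul_eq_one_left hB
  refine ⟨QOnsager.reflB hq hroot * QOnsager.reflC q, QOnsager.reflC q * QOnsager.reflA hq hroot,
    QOnsager.reflC q, QOnsager.action hq hroot, QOnsager.isBaseilhacKolbT₀ hq hroot,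
    QOnsager.isBaseilhacKolbT₁ hq hroot, ?_, ?_, ?_, ?_, ?_, ?_,
    QOnsager.action_injective hq hroot, QOnsager.action_range hq hroot⟩
  · exact ⟨QOnsager.antiLift_mul (QOnsager.isDolanGrady q),
      QOnsager.antiLift_A (QOnsager.isDolanGrady q),
      QOnsager.antiLift_B (QOnsager.isDolanGrady q)⟩
  · rw [QOnsager.action_a]
    exact ⟨QOnsager.antiLift_mul (QOnsager.isDolanGrady_reflA hq hroot),
      QOnsager.antiLift_A (QOnsager.isDolanGrady_reflA hq hroot),
      QOnsager.antiLift_B (QOnsager.isDolanGrady_reflA hq hroot),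
      QOnsager.antiLift_reflA_C hq hroot⟩
  · rw [QOnsager.action_b]
    exact ⟨QOnsager.antiLift_mul (QOnsager.isDolanGrady_reflB hq hroot),
      QOnsager.antiLift_B (QOnsager.isDolanGrady_reflB hq hroot),
      QOnsager.antiLift_reflB_C hq hroot, QOnsager.antiLift_A (QOnsager.isDolanGrady_reflB hq hroot)⟩
  · rw [QOnsager.action_c]
    exact ⟨QOnsager.antiLift_mul (QOnsager.isDolanGrady q),
      QOnsager.reflC_C hq hroot,
      QOnsager.antiLift_A (QOnsager.isDolanGrady q),
      QOnsager.antiLift_B (QOnsager.isDolanGrady q)⟩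
  · rw [QOnsager.action_a, QOnsager.action_b, QOnsager.action_c, mul_inv_rev, mul_inv_rev,
      hA', hB', hC']
    refine ⟨?_, ?_, ?_, ?_, rfl⟩
    · rw [← mul_assoc, hC, one_mul]
    · rw [mul_assoc, hC, mul_one]
    · rw [mul_assoc, hC, mul_one]
    · rw [← mul_assoc, hC, one_mul]
  · simp only [map_mul, QOnsager.action_a, QOnsager.action_b, QOnsager.action_c, mul_inv_rev,
      hA', hB', hC', and_self]
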